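/- Let $m\ge 0$ and $N=2^m$. For $a,b\in\mathbb F_2^m$ put $D(a,b)=X^{a_1}Z^{b_1}\otimes\cdots\otimes X^{a_m}Z^{b_m}$, where $X=\begin{pmatrix}0&1\\1&0\end{pmatrix}$ and $Z=\begin{pmatrix}1&0\\0&-1\end{pmatrix}$, and let $E(a,b)=\imath^{ab^T}D(a,b)$, which is Hermitian. The Heisenberg-Weyl group is $HW_N=\{\imath^\kappa D(a,b):\kappa\in\mathbb Z_4,\ a,b\in\mathbb F_2^m\}$, and the Clifford group $\mathrm{Cliff}_N$ consists of all unitary $N\times N$ matrices $g$ such that $gD(a,b)g^\dagger\in HW_N$ for all $a,b$. The Heisenberg-Weyl graph $\mathbb H_N$ has as vertices the pairs $\pm E(a,b)$ with $[a,b]\ne[0,0]$; two distinct vertices $\pm E(a,b)$, $\pm E(c,d)$ are joined if and only if $E(a,b)$ and $E(c,d)$ commute. $\mathrm{Cliff}_N$ acts on $\mathbb H_N$ by conjugation. By an edge (resp. a non-edge) we mean an ordered pair of distinct vertices that are joined (resp. not joined), and a group acts transitively on vertices, edges or non-edges if any one of them can be mapped to any other. A finite ensemble $\{p_i,U_i\}$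 of unitary $N\times N$ matrices, $U_i$ being selected with probability $p_i$, is a unitary $k$-design if for all linear operators $A$ on $(\mathbb C^N)^{\otimes k}$ $$\sum_i p_i\,U_i^{\otimes k}A(U_i^\dagger)^{\otimes k}=\int_{\mathbb U_N}U^{\otimes k}A(U^\dagger)^{\otimes k}\,d\eta(U),$$ where $\eta$ is the normalized Haar measure on the group $\mathbb U_N$ of unitary $N\times N$ matrices. **Theorem.** Let $G$ be a subgroup of $\mathrm{Cliff}_N$ containing all $D(a,b)$. Let $S$ be either $G$ itself, if $G$ is finite, or any finite subset of $G$ that contains exactly one representative of each element of $G$ up to scalars, and let $\mathcal E=\{\tfrac1{|S|},U\}_{U\in S}$ be the uniform ensemble. If $G$ acts transitively on the vertices of $\mathbb H_N$, then $\mathcal E$ is a unitary $2$-design. If $G$ acts transitively on the vertices, on the edges and on the non-edges of $\mathbb H_N$, then $\mathcal E$ is a unitary $3$-design. -/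

import Mathlib

open MeasureTheory Matrix

noncomputable section

/-- The tensor (Kronecker) product of a finite family of square matrices; rows and columns are
indexed by tuples, `(⨂ A_i)_{x,y} = ∏ i, (A_i)_{x_i, y_i}`. -/
def tensorProd {ι n : Type*} [Fintype ι] (A : ι → Matrix n n ℂ) :
    Matrix (ι → n) (ι → n) ℂ :=
  Matrix.of fun x y => ∏ i, A i (x i) (y i)

theorem tensorProd_mul {ι n : Type*} [Fintype ι] [DecidableEq ι] [Fintype n]
    (A B : ι → Matrix n n ℂ) :
    tensorProd A * tensorProd B = tensorProd fun i => A i * B i := by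
  ext x y
  simp only [tensorProd, Matrix.mul_apply, Matrix.of_apply, Finset.prod_univ_sum,
    Fintype.piFinset_univ, Finset.prod_mul_distrib]

theorem tensorProd_conjTranspose {ι n : Type*} [Fintype ι] (A : ι → Matrix n n ℂ) :
    (tensorProd A)ᴴ = tensorProd fun i => (A i)ᴴ := by
  ext x y
  simp [tensorProd, Matrix.conjTranspose_apply]

theorem tensorProd_one {ι n : Type*} [Fintype ι] [DecidableEq n] :
    tensorProd (fun _ : ι => (1 : Matrix n n ℂ)) = 1 := by
  classical
  ext x y
  simp only [tensorProd, Matrix.of_apply, Matrix.one_apply, Finset.prod_ite_zero]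
  simp [funext_iff]

/-- The `k`-th tensor power `U^{⊗k}`, an operator on `(ℂ^n)^{⊗k}`. -/
def tensorPow {n : Type*} (k : ℕ) (U : Matrix n n ℂ) : Matrix (Fin k → n) (Fin k → n) ℂ :=
  tensorProd fun _ : Fin k => U

/-! ### Pauli matrices, the Heisenberg-Weyl group and the Clifford group -/

/-- Labels of the computational basis of `m` qubits; there are `N = 2^m` of them. -/
abbrev Qubits (m : ℕ) : Type := Fin m → Fin 2

/-- Binary vectors `[a,b]` of length `2m`. -/
abbrev BinVec (m : ℕ) : Type := (Fin m → ZMod 2) × (Fin m → ZMod 2)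

/-- The group `𝕌_N` of unitary `N × N` matrices, `N = 2^m`. -/
abbrev UN (m : ℕ) : Type := Matrix.unitaryGroup (Qubits m) ℂ

def sigmaX : Matrix (Fin 2) (Fin 2) ℂ := !![0, 1; 1, 0]

def sigmaZ : Matrix (Fin 2) (Fin 2) ℂ := !![1, 0; 0, -1]

/-- The matrix `D(a,b) = X^{a₁} Z^{b₁} ⊗ ⋯ ⊗ X^{aₘ} Z^{bₘ}`. -/
def pauliMatrix {m : ℕ} (v : BinVec m) : Matrix (Qubits m) (Qubits m) ℂ :=
  tensorProd fun i => sigmaX ^ (v.1 i).val * sigmaZ ^ (v.2 i).val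

theorem sigmaX_mem : sigmaX ∈ Matrix.unitaryGroup (Fin 2) ℂ := by
  rw [Matrix.mem_unitaryGroup_iff]
  ext i j
  fin_cases i <;> fin_cases j <;> simp [sigmaX, Matrix.mul_apply, Matrix.star_apply]

theorem sigmaZ_mem : sigmaZ ∈ Matrix.unitaryGroup (Fin 2) ℂ := by
  rw [Matrix.mem_unitaryGroup_iff]
  ext i j
  fin_cases i <;> fin_cases j <;> simp [sigmaZ, Matrix.mul_apply, Matrix.star_apply]

theorem pauliMatrix_mem {m : ℕ} (v : BinVec m) :
    pauliMatrix v ∈ Matrix.unitaryGroup (Qubits m) ℂ := by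
  rw [Matrix.mem_unitaryGroup_iff, Matrix.star_eq_conjTranspose, pauliMatrix,
    tensorProd_conjTranspose, tensorProd_mul]
  have h : ∀ i : Fin m, (sigmaX ^ (v.1 i).val * sigmaZ ^ (v.2 i).val) *
      (sigmaX ^ (v.1 i).val * sigmaZ ^ (v.2 i).val)ᴴ = 1 := fun i =>
    Matrix.mem_unitaryGroup_iff.1 (mul_mem (pow_mem sigmaX_mem _) (pow_mem sigmaZ_mem _))
  simp only [h]
  exact tensorProd_one

/-- `D(a,b)` as an element of `𝕌_N`. -/
def pauliD {m : ℕ} (v : BinVec m) : UN m := ⟨pauliMatrix v, pauliMatrix_mem v⟩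

/-- The Heisenberg-Weyl group `HW_N = {i^κ D(a,b) : κ ∈ ℤ/4, a, b ∈ 𝔽₂^m}`, as a set of
matrices. -/
def heisenbergWeyl (m : ℕ) : Set (Matrix (Qubits m) (Qubits m) ℂ) :=
  {M | ∃ (κ : ZMod 4) (v : BinVec m), M = Complex.I ^ κ.val • pauliMatrix v}

/-- The Clifford group `Cliff_N`: the unitary matrices `g` with `g D(a,b) g† ∈ HW_N` for all
`D(a,b)`. -/
def cliffordGroup (m : ℕ) : Set (UN m) :=
  {g | ∀ v : BinVec m,
    (g : Matrix (Qubits m) (Qubits m) ℂ) * pauliMatrix v *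
      (g : Matrix (Qubits m) (Qubits m) ℂ)ᴴ ∈ heisenbergWeyl m}

/-- The Hermitian Pauli matrix `E(a,b) = i^{a bᵀ} D(a,b)`. -/
def pauliE {m : ℕ} (v : BinVec m) : Matrix (Qubits m) (Qubits m) ℂ :=
  Complex.I ^ (v.1 ⬝ᵥ v.2).val • pauliMatrix v

/-! ### The Heisenberg-Weyl graph -/

/-- Vertices of the Heisenberg-Weyl graph: nonzero `[a,b]`, standing for the pair `±E(a,b)`. -/
abbrev HWVertex (m : ℕ) : Type := {v : BinVec m // v ≠ 0}

/-- The Heisenberg-Weyl graph: distinct vertices `±E(a,b)`, `±E(c,d)` are joined iff `E(a,b)` and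
`E(c,d)` commute. -/
def hwGraph (m : ℕ) : SimpleGraph (HWVertex m) where
  Adj v w := v ≠ w ∧ Commute (pauliE v.1) (pauliE w.1)
  symm := ⟨fun _ _ h => ⟨h.1.symm, h.2.symm⟩⟩
  loopless := ⟨fun _ h => h.1 rfl⟩

/-- Conjugation by `g` sends the vertex `±E(v)` to the vertex `±E(w)`. -/
def SendsVertex {m : ℕ} (g : UN m) (v w : HWVertex m) : Prop :=
  (g : Matrix (Qubits m) (Qubits m) ℂ) * pauliE v.1 *
      (g : Matrix (Qubits m) (Qubits m) ℂ)ᴴ = pauliE w.1 ∨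
  (g : Matrix (Qubits m) (Qubits m) ℂ) * pauliE v.1 *
      (g : Matrix (Qubits m) (Qubits m) ℂ)ᴴ = -pauliE w.1

def TransitiveOnVertices {m : ℕ} (G : Subgroup (UN m)) : Prop :=
  ∀ v w : HWVertex m, ∃ g ∈ G, SendsVertex g v w

/-- Transitivity on edges, an edge being an ordered pair of adjacent vertices. -/
def TransitiveOnEdges {m : ℕ} (G : Subgroup (UN m)) : Prop :=
  ∀ v v' w w' : HWVertex m, (hwGraph m).Adj v v' → (hwGraph m).Adj w w' →
    ∃ g ∈ G, SendsVertex g v w ∧ SendsVertex g v' w'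

/-- Transitivity on non-edges, a non-edge being an ordered pair of distinct vertices that are
not adjacent. -/
def TransitiveOnNonEdges {m : ℕ} (G : Subgroup (UN m)) : Prop :=
  ∀ v v' w w' : HWVertex m, v ≠ v' → ¬ (hwGraph m).Adj v v' → w ≠ w' → ¬ (hwGraph m).Adj w w' →
    ∃ g ∈ G, SendsVertex g v w ∧ SendsVertex g v' w'

/-! ### Haar measure and unitary designs -/

instance unitaryGroup_compactSpace {n : Type*} [Fintype n] [DecidableEq n] :
    CompactSpace (Matrix.unitaryGroup n ℂ) := by
  refine isCompact_iff_compactSpace.1 ?_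
  have hK : IsCompact (Set.univ.pi fun _ : n => Set.univ.pi fun _ : n =>
      Metric.closedBall (0 : ℂ) 1) :=
    isCompact_univ_pi fun _ => isCompact_univ_pi fun _ => isCompact_closedBall _ _
  refine IsCompact.of_isClosed_subset (X := Matrix n n ℂ) hK
    (isClosed_unitary (R := Matrix n n ℂ)) ?_
  intro U hU i _ j _
  simpa using entry_norm_bound_of_unitary hU i j

instance unitaryGroup_measurableSpace {n : Type*} [Fintype n] [DecidableEq n] :
    MeasurableSpace (Matrix.unitaryGroup n ℂ) := borel _

instance unitaryGroup_borelSpace {n : Type*} [Fintype n] [DecidableEq n] :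
    BorelSpace (Matrix.unitaryGroup n ℂ) := ⟨rfl⟩

/-- The Haar measure on the unitary group, normalized to total mass `1`. -/
def unitaryHaar (n : Type*) [Fintype n] [DecidableEq n] : Measure (Matrix.unitaryGroup n ℂ) :=
  Measure.haarMeasure ⊤

/-- `U^{⊗k} X (U†)^{⊗k}`. -/
def tensorConj {n : Type*} [Fintype n] [DecidableEq n] (k : ℕ) (U : Matrix.unitaryGroup n ℂ)
    (X : Matrix (Fin k → n) (Fin k → n) ℂ) : Matrix (Fin k → n) (Fin k → n) ℂ :=
  tensorPow k (U : Matrix n n ℂ) * X * tensorPow k (U : Matrix n n ℂ)ᴴ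

/-- The `k`-fold twirl over the whole unitary group; the matrix integral is taken entrywise. -/
def haarTwirl {n : Type*} [Fintype n] [DecidableEq n] (k : ℕ)
    (X : Matrix (Fin k → n) (Fin k → n) ℂ) : Matrix (Fin k → n) (Fin k → n) ℂ :=
  Matrix.of fun x y => ∫ U, tensorConj k U X x y ∂(unitaryHaar n)

/-- A finite ensemble `{p_i, U_i}` of unitary matrices, `U_i` being selected with
probability `p_i`. -/
structure UnitaryEnsemble (n : Type*) [Fintype n] [DecidableEq n] where
  Idx : Type
  [fintypeIdx : Fintype Idx]
  p : Idx → ℝ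
  U : Idx → Matrix.unitaryGroup n ℂ
  p_nonneg : ∀ i, 0 ≤ p i
  p_sum : ∑ i, p i = 1

attribute [instance] UnitaryEnsemble.fintypeIdx

/-- A unitary `k`-design: the `k`-fold twirl over the ensemble coincides with the `k`-fold twirl
over the whole unitary group. -/
def UnitaryEnsemble.IsDesign {n : Type*} [Fintype n] [DecidableEq n] (𝓔 : UnitaryEnsemble n)
    (k : ℕ) : Prop :=
  ∀ X : Matrix (Fin k → n) (Fin k → n) ℂ,
    ∑ i, ((𝓔.p i : ℝ) : ℂ) • tensorConj k (𝓔.U i) X = haarTwirl k X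

/-- The ensemble `{1/|S|, U}_{U ∈ S}` of a nonempty finite set `S` of `N × N` unitary matrices. -/
def uniformEnsemble {m : ℕ} (S : Finset (UN m)) (hS : S.Nonempty) :
    UnitaryEnsemble (Qubits m) where
  Idx := S
  p := fun _ => 1 / (S.card : ℝ)
  U := fun U => U.1
  p_nonneg := fun _ => by positivity
  p_sum := by
    have : (S.card : ℝ) ≠ 0 := by exact_mod_cast hS.card_pos.ne'
    simp [this]

/-- `S ⊆ G` contains exactly one representative of every element of `G` up to scalar multiples
(global phases). -/
def IsPhaseTransversal {m : ℕ} (G : Subgroup (UN m)) (S : Finset (UN m)) : Prop :=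
  (∀ s ∈ S, s ∈ G) ∧
  ∀ g ∈ G, ∃! s : UN m, s ∈ S ∧ ∃ c : ℂ,
    (g : Matrix (Qubits m) (Qubits m) ℂ) = c • (s : Matrix (Qubits m) (Qubits m) ℂ)

end

/-! Let `F` be the difference of the ensemble twirl and the Haar twirl on `k`-fold tensors. It is
linear, invariant under conjugation by `g^{⊗k}` for every `g ∈ G` (right translation permutes `S` up
to phases and preserves Haar measure), and zero on operators permuting the tensor factors, which
both twirls fix. These properties force `F = 0`; the commutant of the tensor powers never has to be
determined.

Tensors of Pauli matrices `D(u_i)` span. If `∑ u_i ≠ 0`, some Pauli matrix in `G` conjugates the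
tensor to its negative, so `F` kills it. For `k = 2` there remain, up to scalars, the `D(v) ⊗
D(v)†`. The phases produced by conjugation cancel, so by vertex transitivity `F` is constant on them
for `v ≠ 0`. At `v = 0` the tensor is the identity, and the sum over all `v` is a multiple of the
swap; hence the constant is zero.

For `k = 3` there remain the `D(v) ⊗ D(v)†D(w) ⊗ D(w)†`. The pairs `(v, w)` fall into six families:
both zero, `w = 0`, `v = 0`, `v = w`, edges, non-edges. `F` is constant on each, and the six
permutations of three factors supply six linear relations: the identity settles the first family,
the transpositions the next three, and the two 3-cycles, as plain and sign-weighted sums over all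
pairs, settle edges and non-edges (`map_pauliTriple_eq_zero`). -/

noncomputable section

/-! ### Tensor products, conjugation by tensor powers, permutation operators. -/

section TensorProducts

variable {ι n : Type*} [Fintype ι]

theorem tensorProd_smul (c : ι → ℂ) (A : ι → Matrix n n ℂ) :
    tensorProd (fun i => c i • A i) = (∏ i, c i) • tensorProd A := by
  ext x y
  simp [tensorProd, Finset.prod_mul_distrib]

theorem tensorProd_sum [DecidableEq ι] {J : Type*} [Fintype J] (A : ι → J → Matrix n n ℂ) :
    tensorProd (fun i => ∑ j, A i j) = ∑ r : ι → J, tensorProd fun i => A i (r i) := by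
  ext x y
  simp only [tensorProd, Matrix.of_apply, Matrix.sum_apply, Finset.prod_univ_sum,
    Fintype.piFinset_univ]

theorem tensorProd_single [DecidableEq n] (x y : ι → n) [DecidableEq (ι → n)] :
    tensorProd (fun i => Matrix.single (x i) (y i) (1 : ℂ)) = Matrix.single x y 1 := by
  classical
  ext x' y'
  simp only [tensorProd, Matrix.of_apply, Matrix.single_apply, Finset.prod_ite_zero,
    Finset.prod_const_one, Finset.mem_univ, true_imp_iff, forall_and, funext_iff]

/-- Tensor products of members of a spanning family of matrices span. -/
theorem span_tensorProd_eq_top [DecidableEq ι] [Fintype n] [DecidableEq n] {J : Type*} [Fintype J]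
    {e : J → Matrix n n ℂ} (he : Submodule.span ℂ (Set.range e) = ⊤) :
    Submodule.span ℂ (Set.range fun r : ι → J => tensorProd fun i => e (r i)) = ⊤ := by
  have hprod : ∀ A : ι → Matrix n n ℂ, tensorProd A ∈
      Submodule.span ℂ (Set.range fun r : ι → J => tensorProd fun i => e (r i)) := by
    intro A
    have hA : ∀ i, ∃ c : J → ℂ, ∑ j, c j • e j = A i := fun i =>
      (Submodule.mem_span_range_iff_exists_fun ℂ).1 (he ▸ Submodule.mem_top)
    choose c hc using hA
    have : A = fun i => ∑ j, c i j • e j := funext fun i => (hc i).symm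
    rw [this, tensorProd_sum]
    refine Submodule.sum_mem _ fun r _ => ?_
    rw [tensorProd_smul (fun i => c i (r i)) (fun i => e (r i))]
    exact Submodule.smul_mem _ _ (Submodule.subset_span ⟨r, rfl⟩)
  rw [eq_top_iff]
  intro X _
  rw [Matrix.matrix_eq_sum_single X]
  refine Submodule.sum_mem _ fun x _ => Submodule.sum_mem _ fun y _ => ?_
  have := Submodule.smul_mem _ (X x y) (hprod fun i => Matrix.single (x i) (y i) 1)
  rwa [tensorProd_single, Matrix.smul_single, smul_eq_mul, mul_one] at this

variable [Fintype n] [DecidableEq n]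

theorem tensorConj_tensorProd {k : ℕ} (U : Matrix.unitaryGroup n ℂ) (A : Fin k → Matrix n n ℂ) :
    tensorConj k U (tensorProd A) =
      tensorProd fun i => (U : Matrix n n ℂ) * A i * (U : Matrix n n ℂ)ᴴ := by
  simp only [tensorConj, tensorPow, tensorProd_mul]

theorem tensorPow_mul_conjTranspose (k : ℕ) (U : Matrix.unitaryGroup n ℂ) :
    tensorPow k (U : Matrix n n ℂ) * tensorPow k (U : Matrix n n ℂ)ᴴ = 1 := by
  simp only [tensorPow, tensorProd_mul]
  rw [← Matrix.star_eq_conjTranspose, Unitary.mul_star_self_of_mem U.2, tensorProd_one]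

theorem tensorConj_mul (k : ℕ) (U V : Matrix.unitaryGroup n ℂ)
    (X : Matrix (Fin k → n) (Fin k → n) ℂ) :
    tensorConj k (U * V) X = tensorConj k U (tensorConj k V X) := by
  have h1 : tensorPow k ((U * V : Matrix.unitaryGroup n ℂ) : Matrix n n ℂ) =
      tensorPow k (U : Matrix n n ℂ) * tensorPow k (V : Matrix n n ℂ) := by
    simp [tensorPow, tensorProd_mul]
  have h2 : tensorPow k ((U * V : Matrix.unitaryGroup n ℂ) : Matrix n n ℂ)ᴴ =
      tensorPow k (V : Matrix n n ℂ)ᴴ * tensorPow k (U : Matrix n n ℂ)ᴴ := by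
    simp [tensorPow, tensorProd_mul, Matrix.conjTranspose_mul]
  simp only [tensorConj, h1, h2, Matrix.mul_assoc]

/-- Unitarity forces `|c| = 1`, as a diagonal entry of `U U† = 1` shows, so `c ^ k` cancels against
its conjugate. Hence twirls see unitaries only up to phase, and a phase transversal serves as well
as `G`. -/
theorem tensorConj_eq_of_smul [Nonempty n] (k : ℕ) {U V : Matrix.unitaryGroup n ℂ} {c : ℂ}
    (h : (U : Matrix n n ℂ) = c • (V : Matrix n n ℂ)) (X : Matrix (Fin k → n) (Fin k → n) ℂ) :
    tensorConj k U X = tensorConj k V X := by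
  have hc : c * star c = 1 := by
    have hU := Unitary.mul_star_self_of_mem U.2
    rw [h, star_smul, smul_mul_smul_comm, Unitary.mul_star_self_of_mem V.2] at hU
    obtain ⟨i⟩ := ‹Nonempty n›
    simpa using congrFun (congrFun hU i) i
  have h1 : tensorPow k (c • (V : Matrix n n ℂ)) = c ^ k • tensorPow k (V : Matrix n n ℂ) := by
    simpa [tensorPow] using tensorProd_smul (fun _ : Fin k => c) fun _ => (V : Matrix n n ℂ)
  have h2 : tensorPow k (c • (V : Matrix n n ℂ))ᴴ =
      star c ^ k • tensorPow k (V : Matrix n n ℂ)ᴴ := by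
    simpa [Matrix.conjTranspose_smul, tensorPow] using
      tensorProd_smul (fun _ : Fin k => star c) fun _ => (V : Matrix n n ℂ)ᴴ
  rw [tensorConj, tensorConj, h, h1, h2, Matrix.smul_mul, smul_mul_smul_comm, ← mul_pow, hc,
    one_pow, one_smul]

/-- The operator on `(ℂ^n)^{⊗k}` that permutes the tensor factors. -/
def permOp (k : ℕ) (σ : Equiv.Perm (Fin k)) : Matrix (Fin k → n) (Fin k → n) ℂ :=
  Matrix.of fun x y => if x = y ∘ σ then 1 else 0

theorem tensorPow_mul_permOp (k : ℕ) (σ : Equiv.Perm (Fin k)) (U : Matrix n n ℂ) :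
    tensorPow k U * permOp k σ = permOp k σ * tensorPow k U := by
  ext x y
  have h : ∀ z : Fin k → n, x = z ∘ σ ↔ x ∘ σ.symm = z := fun z =>
    ⟨fun h => by rw [h]; ext; simp, fun h => by rw [← h]; ext; simp⟩
  simp only [Matrix.mul_apply, permOp, tensorPow, tensorProd, Matrix.of_apply, mul_ite, mul_one,
    mul_zero, ite_mul, one_mul, zero_mul, Finset.sum_ite_eq', Finset.sum_ite_eq, Finset.mem_univ,
    if_true, h]
  simpa using Equiv.prod_comp σ fun i => U (x (σ.symm i)) (y i)

theorem tensorConj_permOp (k : ℕ) (σ : Equiv.Perm (Fin k)) (U : Matrix.unitaryGroup n ℂ) :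
    tensorConj k U (permOp k σ) = permOp k σ := by
  rw [tensorConj, tensorPow_mul_permOp, Matrix.mul_assoc, tensorPow_mul_conjTranspose,
    Matrix.mul_one]

end TensorProducts

/-! ### Haar and ensemble twirls, and the invariance of their difference. -/

section Twirls

variable {n : Type*} [Fintype n] [DecidableEq n]

instance isProbabilityMeasure_unitaryHaar : IsProbabilityMeasure (unitaryHaar n) :=
  ⟨Measure.haarMeasure_self (K₀ := ⊤)⟩

instance isHaarMeasure_unitaryHaar : (unitaryHaar n).IsHaarMeasure :=
  inferInstanceAs (Measure.haarMeasure ⊤).IsHaarMeasure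

/-- Compact groups are unimodular: a right translate of Haar measure is again a Haar probability
measure, and that is unique. -/
instance isMulRightInvariant_unitaryHaar : (unitaryHaar n).IsMulRightInvariant where
  map_mul_right_eq_self g := by
    have : IsProbabilityMeasure ((unitaryHaar n).map (· * g)) :=
      Measure.isProbabilityMeasure_map (measurable_mul_const g).aemeasurable
    exact Measure.isHaarMeasure_eq_of_isProbabilityMeasure _ _

theorem continuous_tensorConj_apply (k : ℕ) (X : Matrix (Fin k → n) (Fin k → n) ℂ)
    (x y : Fin k → n) : Continuous fun U => tensorConj k U X x y := by
  have h : ∀ i j, Continuous fun U : Matrix.unitaryGroup n ℂ => (U : Matrix n n ℂ) i j :=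
    fun i j => continuous_subtype_val.matrix_elem i j
  simp only [tensorConj, tensorPow, tensorProd, Matrix.mul_apply, Matrix.of_apply,
    Matrix.conjTranspose_apply]
  refine continuous_finsetSum _ fun i _ => Continuous.mul (continuous_finsetSum _ fun j _ =>
    Continuous.mul (continuous_finsetProd _ fun l _ => h _ _) continuous_const)
    (continuous_finsetProd _ fun l _ => (h _ _).star)

theorem integrable_tensorConj_apply (k : ℕ) (X : Matrix (Fin k → n) (Fin k → n) ℂ)
    (x y : Fin k → n) : Integrable (fun U => tensorConj k U X x y) (unitaryHaar n) :=
  (continuous_tensorConj_apply k X x y).integrable_of_hasCompactSupport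
    (HasCompactSupport.of_compactSpace _)

theorem haarTwirl_add (k : ℕ) (X Y : Matrix (Fin k → n) (Fin k → n) ℂ) :
    haarTwirl k (X + Y) = haarTwirl k X + haarTwirl k Y := by
  ext x y
  simp only [haarTwirl, Matrix.of_apply, Matrix.add_apply]
  rw [← integral_add (integrable_tensorConj_apply k X x y) (integrable_tensorConj_apply k Y x y)]
  simp [tensorConj, Matrix.mul_add, Matrix.add_mul]

theorem haarTwirl_smul (k : ℕ) (c : ℂ) (X : Matrix (Fin k → n) (Fin k → n) ℂ) :
    haarTwirl k (c • X) = c • haarTwirl k X := by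
  ext x y
  simp only [haarTwirl, Matrix.of_apply, Matrix.smul_apply]
  rw [← integral_smul]
  simp [tensorConj]

theorem haarTwirl_tensorConj (k : ℕ) (g : Matrix.unitaryGroup n ℂ)
    (X : Matrix (Fin k → n) (Fin k → n) ℂ) :
    haarTwirl k (tensorConj k g X) = haarTwirl k X := by
  ext x y
  simp only [haarTwirl, Matrix.of_apply, ← tensorConj_mul]
  exact integral_mul_right_eq_self (fun U => tensorConj k U X x y) g

theorem haarTwirl_permOp (k : ℕ) (σ : Equiv.Perm (Fin k)) :
    haarTwirl k (permOp k σ : Matrix (Fin k → n) (Fin k → n) ℂ) = permOp k σ := by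
  ext x y
  simp [haarTwirl, tensorConj_permOp]

/-- The difference of the twirls over a finite ensemble and over the unitary group. -/
def UnitaryEnsemble.twirlDefect (𝓔 : UnitaryEnsemble n) (k : ℕ) :
    Matrix (Fin k → n) (Fin k → n) ℂ →ₗ[ℂ] Matrix (Fin k → n) (Fin k → n) ℂ where
  toFun X := ∑ i, ((𝓔.p i : ℝ) : ℂ) • tensorConj k (𝓔.U i) X - haarTwirl k X
  map_add' X Y := by
    simp only [haarTwirl_add, tensorConj, Matrix.mul_add, Matrix.add_mul, smul_add,
      Finset.sum_add_distrib]
    abel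
  map_smul' c X := by
    simp only [haarTwirl_smul, tensorConj, Matrix.mul_smul, Matrix.smul_mul, RingHom.id_apply,
      smul_sub, Finset.smul_sum, smul_comm c]

theorem UnitaryEnsemble.twirlDefect_permOp (𝓔 : UnitaryEnsemble n) (k : ℕ)
    (σ : Equiv.Perm (Fin k)) : 𝓔.twirlDefect k (permOp k σ) = 0 := by
  have h : (∑ i, ((𝓔.p i : ℝ) : ℂ)) = 1 := by exact_mod_cast 𝓔.p_sum
  simp only [twirlDefect, LinearMap.coe_mk, AddHom.coe_mk, tensorConj_permOp, haarTwirl_permOp,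
    ← Finset.sum_smul, h, one_smul, sub_self]

theorem UnitaryEnsemble.isDesign_of_twirlDefect_eq_zero {𝓔 : UnitaryEnsemble n} {k : ℕ}
    (h : 𝓔.twirlDefect k = 0) : 𝓔.IsDesign k := fun X =>
  sub_eq_zero.1 (LinearMap.congr_fun h X)

/-- Right translation by `g ∈ G` permutes `S` up to scalars. -/
theorem exists_perm_mul_right {m : ℕ} {G : Subgroup (UN m)} {S : Finset (UN m)}
    (hS : (S : Set (UN m)) = G ∨ IsPhaseTransversal G S) {g : UN m} (hg : g ∈ G) :
    ∃ r : S → S, Function.Bijective r ∧ ∀ s : S, ∃ c : ℂ,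
      ((s.1 * g : UN m) : Matrix (Qubits m) (Qubits m) ℂ) = c • (r s).1.1 := by
  rcases hS with hS | ⟨hSG, hS⟩
  · have hmem : ∀ s, s ∈ S ↔ s ∈ G := fun s => by
      rw [← SetLike.mem_coe (p := G), ← hS, Finset.mem_coe]
    refine ⟨fun s => ⟨s.1 * g, (hmem _).2 (G.mul_mem ((hmem _).1 s.2) hg)⟩,
      Finite.injective_iff_bijective.1 fun s s' h => ?_, fun s => ⟨1, by simp⟩⟩
    exact Subtype.ext (mul_right_cancel (congrArg Subtype.val h))
  · have hex : ∀ s : S, ∃ t : S, ∃ c : ℂ,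
        ((s.1 * g : UN m) : Matrix (Qubits m) (Qubits m) ℂ) = c • t.1.1 := fun s => by
      obtain ⟨t, ⟨ht, c, hc⟩, -⟩ := hS (s.1 * g) (G.mul_mem (hSG _ s.2) hg)
      exact ⟨⟨t, ht⟩, c, hc⟩
    choose r c hc using hex
    refine ⟨r, Finite.injective_iff_bijective.1 fun s s' h => ?_, fun s => ⟨c s, hc s⟩⟩
    -- Undoing the translation shows that `r s = r s'` makes `s` a multiple of `s'`; both then
    -- represent `s` in the transversal, so they coincide.
    have hsplit : ∀ t : S, (t.1.1 : Matrix (Qubits m) (Qubits m) ℂ) =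
        c t • ((r t).1.1 * (g⁻¹ : UN m).1) := fun t => by
      rw [← Matrix.smul_mul, ← hc t]
      exact congrArg Subtype.val (mul_inv_cancel_right t.1 g).symm
    have hne : c s' ≠ 0 := fun h0 => by
      have h1 := Unitary.mul_star_self_of_mem s'.1.2
      rw [hsplit s', h0, zero_smul, zero_mul] at h1
      exact zero_ne_one h1
    refine Subtype.ext ((hS s.1 (hSG _ s.2)).unique ⟨s.2, 1, (one_smul _ _).symm⟩
      ⟨s'.2, c s * (c s')⁻¹, ?_⟩)
    rw [hsplit s', smul_smul, inv_mul_cancel_right₀ hne, ← h, ← hsplit s]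

/-- On the ensemble side `g` merely reindexes the sum along `r`; on the Haar side it is absorbed by
right invariance. -/
theorem UnitaryEnsemble.twirlDefect_tensorConj {𝓔 : UnitaryEnsemble n} {k : ℕ}
    {g : Matrix.unitaryGroup n ℂ} {r : 𝓔.Idx → 𝓔.Idx} (hr : Function.Bijective r)
    (hp : ∀ i, 𝓔.p (r i) = 𝓔.p i)
    (h : ∀ i X, tensorConj k (𝓔.U i * g) X = tensorConj k (𝓔.U (r i)) X)
    (X : Matrix (Fin k → n) (Fin k → n) ℂ) :
    𝓔.twirlDefect k (tensorConj k g X) = 𝓔.twirlDefect k X := by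
  simp only [twirlDefect, LinearMap.coe_mk, AddHom.coe_mk, haarTwirl_tensorConj,
    ← tensorConj_mul, h]
  congr 1
  rw [← hr.sum_comp fun i => ((𝓔.p i : ℝ) : ℂ) • tensorConj k (𝓔.U i) X]
  simp only [hp]

theorem twirlDefect_uniformEnsemble_tensorConj {m : ℕ} {G : Subgroup (UN m)} {S : Finset (UN m)}
    (hne : S.Nonempty) (hS : (S : Set (UN m)) = G ∨ IsPhaseTransversal G S) {g : UN m}
    (hg : g ∈ G) (k : ℕ) (X : Matrix (Fin k → Qubits m) (Fin k → Qubits m) ℂ) :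
    (uniformEnsemble S hne).twirlDefect k (tensorConj k g X) =
      (uniformEnsemble S hne).twirlDefect k X := by
  obtain ⟨r, hr, hc⟩ := exists_perm_mul_right hS hg
  refine UnitaryEnsemble.twirlDefect_tensorConj (𝓔 := uniformEnsemble S hne) (r := r) hr
    (fun _ => rfl) (fun s X => ?_) X
  obtain ⟨c, hc⟩ := hc s
  exact tensorConj_eq_of_smul k hc X

end Twirls

/-! ### Pauli algebra, the symplectic form, completeness relations. -/

section PauliMatrices

theorem zmodTwo_eq_zero_or_one (a : ZMod 2) : a = 0 ∨ a = 1 := by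
  revert a
  decide

/-- The sign `(-1)^a` of a bit. -/
def bitSign (a : ZMod 2) : ℂ := (-1) ^ a.val

theorem bitSign_zero : bitSign 0 = 1 := by simp [bitSign]

theorem bitSign_one : bitSign 1 = -1 := by simp [bitSign, ZMod.val_one]

theorem bitSign_eq_one_or (a : ZMod 2) : bitSign a = 1 ∨ bitSign a = -1 := by
  rcases zmodTwo_eq_zero_or_one a with rfl | rfl
  · exact Or.inl bitSign_zero
  · exact Or.inr bitSign_one

theorem bitSign_ne_zero (a : ZMod 2) : bitSign a ≠ 0 := by
  rcases bitSign_eq_one_or a with h | h <;> simp [h]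

theorem bitSign_add (a b : ZMod 2) : bitSign (a + b) = bitSign a * bitSign b := by
  have h : (1 + 1 : ZMod 2) = 0 := rfl
  rcases zmodTwo_eq_zero_or_one a with rfl | rfl <;>
    rcases zmodTwo_eq_zero_or_one b with rfl | rfl <;>
    simp [bitSign_zero, bitSign_one, h]

theorem bitSign_sum {ι : Type*} (s : Finset ι) (a : ι → ZMod 2) :
    bitSign (∑ i ∈ s, a i) = ∏ i ∈ s, bitSign (a i) := by
  classical
  induction s using Finset.induction_on with
  | empty => simp [bitSign_zero]
  | insert i s hi ih => rw [Finset.sum_insert hi, Finset.prod_insert hi, bitSign_add, ih]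

/-- The one-qubit Pauli matrix `X^a Z^b`. -/
def pauliOne (p : ZMod 2 × ZMod 2) : Matrix (Fin 2) (Fin 2) ℂ := sigmaX ^ p.1.val * sigmaZ ^ p.2.val

theorem pauliOne_mul (p q : ZMod 2 × ZMod 2) :
    pauliOne p * pauliOne q = bitSign (p.2 * q.1) • pauliOne (p + q) := by
  obtain ⟨a, b⟩ := p
  obtain ⟨c, d⟩ := q
  have hX : sigmaX * sigmaX = 1 := by
    ext i j; fin_cases i <;> fin_cases j <;> simp [sigmaX, Matrix.mul_apply]
  have hZ : sigmaZ * sigmaZ = 1 := by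
    ext i j; fin_cases i <;> fin_cases j <;> simp [sigmaZ, Matrix.mul_apply]
  have h : (1 + 1 : ZMod 2) = 0 := rfl
  have hZX : sigmaZ * sigmaX = -(sigmaX * sigmaZ) := by
    ext i j; fin_cases i <;> fin_cases j <;> simp [sigmaX, sigmaZ, Matrix.mul_apply]
  have hX' : ∀ M, sigmaX * (sigmaX * M) = M := fun M => by rw [← mul_assoc, hX, one_mul]
  have hZX' : ∀ M, sigmaZ * (sigmaX * M) = -(sigmaX * (sigmaZ * M)) := fun M => by
    rw [← mul_assoc, hZX, neg_mul, mul_assoc]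
  rcases zmodTwo_eq_zero_or_one a with rfl | rfl <;>
    rcases zmodTwo_eq_zero_or_one b with rfl | rfl <;>
    rcases zmodTwo_eq_zero_or_one c with rfl | rfl <;>
    rcases zmodTwo_eq_zero_or_one d with rfl | rfl <;>
    simp [pauliOne, bitSign, ZMod.val_one, h, hX, hZ, hZX, hX', hZX', mul_assoc]

theorem pauliOne_conjTranspose (p : ZMod 2 × ZMod 2) :
    (pauliOne p)ᴴ = bitSign (p.1 * p.2) • pauliOne p := by
  obtain ⟨a, b⟩ := p
  ext i j
  rcases zmodTwo_eq_zero_or_one a with rfl | rfl <;>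
    rcases zmodTwo_eq_zero_or_one b with rfl | rfl <;>
    fin_cases i <;> fin_cases j <;>
    simp [pauliOne, sigmaX, sigmaZ, bitSign, ZMod.val_one, Matrix.conjTranspose_apply]

/-- Completeness: the four matrices divided by `√2` form an orthonormal basis for the
Hilbert-Schmidt inner product. -/
theorem sum_pauliOne_mul_star (x y x' y' : Fin 2) :
    ∑ p, pauliOne p x y * star (pauliOne p x' y') = if x = x' ∧ y = y' then 2 else 0 := by
  rw [Fintype.sum_prod_type]
  have h : ∀ f : ZMod 2 → ℂ, ∑ a, f a = f 0 + f 1 := Fin.sum_univ_two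
  simp only [h]
  fin_cases x <;> fin_cases y <;> fin_cases x' <;> fin_cases y' <;>
    norm_num [pauliOne, sigmaX, sigmaZ, ZMod.val_one, Matrix.mul_apply]

theorem span_pauliOne : Submodule.span ℂ (Set.range pauliOne) = ⊤ := by
  rw [eq_top_iff]
  intro X _
  -- The coefficient of `pauliOne p` is half its Hilbert-Schmidt inner product with `X`.
  have h : X = ∑ p, (2⁻¹ * ∑ x, ∑ y, X x y * star (pauliOne p x y)) • pauliOne p := by
    ext x' y'
    simp only [Matrix.sum_apply, Matrix.smul_apply, smul_eq_mul, mul_assoc, Finset.sum_mul]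
    rw [← Finset.mul_sum, Finset.sum_comm]
    have : ∀ x, ∑ p, ∑ y, X x y * (star (pauliOne p x y) * pauliOne p x' y') =
        ∑ y, X x y * if x' = x ∧ y' = y then 2 else 0 := fun x => by
      rw [Finset.sum_comm]
      refine Finset.sum_congr rfl fun y _ => ?_
      rw [← sum_pauliOne_mul_star, Finset.mul_sum]
      exact Finset.sum_congr rfl fun p _ => by ring
    simp only [this]
    fin_cases x' <;> fin_cases y' <;> simp <;> ring
  rw [h]
  exact Submodule.sum_mem _ fun p _ => Submodule.smul_mem _ _ (Submodule.subset_span ⟨p, rfl⟩)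

variable {m : ℕ}

theorem pauliMatrix_eq (v : BinVec m) :
    pauliMatrix v = tensorProd fun i => pauliOne (v.1 i, v.2 i) := rfl

theorem pauliMatrix_zero : pauliMatrix (0 : BinVec m) = 1 := by
  rw [← tensorProd_one]
  simp [pauliMatrix]

theorem pauliMatrix_mul (v w : BinVec m) :
    pauliMatrix v * pauliMatrix w = bitSign (v.2 ⬝ᵥ w.1) • pauliMatrix (v + w) := by
  simp only [pauliMatrix_eq, tensorProd_mul, pauliOne_mul]
  rw [tensorProd_smul (fun i => bitSign (v.2 i * w.1 i)), dotProduct, bitSign_sum]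
  rfl

theorem pauliMatrix_conjTranspose (v : BinVec m) :
    (pauliMatrix v)ᴴ = bitSign (v.1 ⬝ᵥ v.2) • pauliMatrix v := by
  simp only [pauliMatrix_eq, tensorProd_conjTranspose, pauliOne_conjTranspose]
  rw [tensorProd_smul (fun i => bitSign (v.1 i * v.2 i)), dotProduct, bitSign_sum]

/-- The symplectic form on binary vectors. -/
def sympForm (v w : BinVec m) : ZMod 2 := v.2 ⬝ᵥ w.1 + v.1 ⬝ᵥ w.2

theorem sympForm_add_right (v w w' : BinVec m) :
    sympForm v (w + w') = sympForm v w + sympForm v w' := by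
  simp only [sympForm, Prod.fst_add, Prod.snd_add, dotProduct_add]
  abel

theorem sympForm_sum_right {ι : Type*} (v : BinVec m) (s : Finset ι) (w : ι → BinVec m) :
    sympForm v (∑ i ∈ s, w i) = ∑ i ∈ s, sympForm v (w i) :=
  map_sum (AddMonoidHom.mk' (sympForm v) (sympForm_add_right v)) w s

/-- Nondegeneracy of the form: a standard basis vector in the opposite half detects a nonzero
coordinate of `v`. -/
theorem exists_sympForm_eq_one {v : BinVec m} (hv : v ≠ 0) : ∃ w, sympForm w v = 1 := by
  have h01 : ∀ a : ZMod 2, a ≠ 0 → a = 1 := by decide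
  by_cases h : v.1 = 0
  · have h2 : v.2 ≠ 0 := fun h2 => hv (Prod.ext h h2)
    obtain ⟨i, hi⟩ := Function.ne_iff.1 h2
    exact ⟨(Pi.single i 1, 0), by simpa [sympForm] using h01 _ hi⟩
  · obtain ⟨i, hi⟩ := Function.ne_iff.1 h
    exact ⟨(0, Pi.single i 1), by simpa [sympForm] using h01 _ hi⟩

theorem pauliMatrix_mul_comm (v w : BinVec m) :
    pauliMatrix v * pauliMatrix w = bitSign (sympForm v w) • (pauliMatrix w * pauliMatrix v) := by
  rw [pauliMatrix_mul, pauliMatrix_mul, smul_smul, sympForm, bitSign_add, add_comm w v,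
    dotProduct_comm w.2]
  rcases bitSign_eq_one_or (v.1 ⬝ᵥ w.2) with h | h <;> simp [h]

theorem pauliMatrix_mul_conjTranspose (v : BinVec m) :
    pauliMatrix v * (pauliMatrix v)ᴴ = 1 :=
  Unitary.mul_star_self_of_mem (pauliMatrix_mem v)

theorem pauliMatrix_conjTranspose_mul (v : BinVec m) :
    (pauliMatrix v)ᴴ * pauliMatrix v = 1 :=
  Unitary.star_mul_self_of_mem (pauliMatrix_mem v)

theorem pauliMatrix_conj (v w : BinVec m) :
    pauliMatrix v * pauliMatrix w * (pauliMatrix v)ᴴ =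
      bitSign (sympForm v w) • pauliMatrix w := by
  rw [pauliMatrix_mul_comm, Matrix.smul_mul, Matrix.mul_assoc, pauliMatrix_mul_conjTranspose,
    Matrix.mul_one]

theorem conjTranspose_pauliMatrix_mul_comm (v w : BinVec m) :
    (pauliMatrix v)ᴴ * pauliMatrix w =
      bitSign (sympForm v w) • (pauliMatrix w * (pauliMatrix v)ᴴ) := by
  simp only [pauliMatrix_conjTranspose, Matrix.smul_mul, Matrix.mul_smul]
  rw [pauliMatrix_mul_comm, smul_comm]

theorem pauliMatrix_ne_zero (v : BinVec m) : pauliMatrix v ≠ 0 := fun h => by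
  have := pauliMatrix_mul_conjTranspose v
  rw [h, zero_mul] at this
  exact zero_ne_one this

/-- The phases are nonzero scalars and do not matter. When the form is 1 the matrices anticommute,
and their product is nonzero, so they cannot also commute. -/
theorem commute_pauliE_iff (v w : BinVec m) :
    Commute (pauliE v) (pauliE w) ↔ sympForm v w = 0 := by
  have hI : ∀ k : ℕ, Complex.I ^ k ≠ 0 := fun k => pow_ne_zero _ Complex.I_ne_zero
  have hne : pauliMatrix w * pauliMatrix v ≠ 0 := by
    rw [pauliMatrix_mul]
    exact smul_ne_zero (bitSign_ne_zero _) (pauliMatrix_ne_zero _)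
  rw [pauliE, pauliE, Commute.smul_left_iff₀ (hI _), Commute.smul_right_iff₀ (hI _), Commute,
    SemiconjBy, pauliMatrix_mul_comm v w]
  rcases zmodTwo_eq_zero_or_one (sympForm v w) with h | h
  · simp [h, bitSign_zero]
  · simp only [h, bitSign_one, neg_smul, one_smul, one_ne_zero, iff_false]
    intro h'
    have h2 := eq_neg_iff_add_eq_zero.1 h'.symm
    rw [← two_smul ℂ] at h2
    exact hne ((smul_eq_zero.1 h2).resolve_left two_ne_zero)

theorem span_pauliMatrix : Submodule.span ℂ (Set.range (pauliMatrix (m := m))) = ⊤ := by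
  rw [← span_tensorProd_eq_top (ι := Fin m) span_pauliOne]
  congr 1
  exact ((Equiv.arrowProdEquivProdArrow (Fin m) (fun _ => ZMod 2)
    fun _ => ZMod 2).surjective.range_comp pauliMatrix).symm

/-- The sum over labels factors over qubits into one-qubit completeness relations. All the Pauli
sums below are contractions of this identity. -/
theorem sum_pauliMatrix_mul_star (x y x' y' : Qubits m) :
    ∑ v, pauliMatrix v x y * star (pauliMatrix v x' y') =
      if x = x' ∧ y = y' then 2 ^ m else 0 := by
  rw [← (Equiv.arrowProdEquivProdArrow (Fin m) (fun _ => ZMod 2) fun _ => ZMod 2).sum_comp]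
  have h : ∀ r : Fin m → ZMod 2 × ZMod 2,
      pauliMatrix (Equiv.arrowProdEquivProdArrow _ _ _ r) x y *
        star (pauliMatrix (Equiv.arrowProdEquivProdArrow _ _ _ r) x' y') =
      ∏ i, pauliOne (r i) (x i) (y i) * star (pauliOne (r i) (x' i) (y' i)) := fun r => by
    rw [Finset.prod_mul_distrib, ← star_prod]
    rfl
  rw [Finset.sum_congr rfl fun r _ => h r, ← Fintype.piFinset_univ,
    ← Finset.prod_univ_sum (fun _ => Finset.univ) fun i r =>
      pauliOne r (x i) (y i) * star (pauliOne r (x' i) (y' i))]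
  simp only [sum_pauliOne_mul_star, Finset.prod_ite_zero]
  simp [forall_and, funext_iff]

/-- Passing from `E` to `D` turns the sign into a phase. Only its modulus matters later, since
phases will meet their conjugates. -/
theorem SendsVertex.exists_smul {g : UN m} {v w : HWVertex m} (h : SendsVertex g v w) :
    ∃ c : ℂ, star c * c = 1 ∧ (g : Matrix (Qubits m) (Qubits m) ℂ) * pauliMatrix v.1 *
      (g : Matrix (Qubits m) (Qubits m) ℂ)ᴴ = c • pauliMatrix w.1 := by
  obtain ⟨s, hs, h⟩ : ∃ s : ℂ, ‖s‖ = 1 ∧ (g : Matrix (Qubits m) (Qubits m) ℂ) * pauliE v.1 *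
      (g : Matrix (Qubits m) (Qubits m) ℂ)ᴴ = s • pauliE w.1 := by
    rcases h with h | h
    · exact ⟨1, by simp, by simpa using h⟩
    · exact ⟨-1, by simp, by simpa using h⟩
  simp only [pauliE, Matrix.mul_smul, Matrix.smul_mul, smul_smul] at h
  refine ⟨(Complex.I ^ (v.1.1 ⬝ᵥ v.1.2).val)⁻¹ * (s * Complex.I ^ (w.1.1 ⬝ᵥ w.1.2).val), ?_, ?_⟩
  · rw [← starRingEnd_apply, Complex.conj_mul']
    simp [hs]
  · rw [mul_smul, ← h, inv_smul_smul₀ (pow_ne_zero _ Complex.I_ne_zero)]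

end PauliMatrices

/-! ### Permutation operators as sums of Pauli tensors. -/

section PauliSums

variable {m : ℕ}

theorem sum_pauli_tensor_two :
    ∑ v : BinVec m, tensorProd ![pauliMatrix v, (pauliMatrix v)ᴴ] =
      (2 : ℂ) ^ m • permOp 2 (Equiv.swap 0 1) := by
  ext x y
  simp only [Matrix.sum_apply, tensorProd, Matrix.of_apply, Fin.prod_univ_two, Matrix.cons_val,
    Matrix.conjTranspose_apply, sum_pauliMatrix_mul_star, permOp, Matrix.smul_apply, funext_iff,
    Fin.forall_fin_two, Function.comp_apply, Equiv.swap_apply_left, Equiv.swap_apply_right]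
  simp [eq_comm]

theorem permOp_three_apply {n : Type*} [Fintype n] [DecidableEq n] (σ : Equiv.Perm (Fin 3))
    (x y : Fin 3 → n) : permOp 3 σ x y =
      if x 0 = y (σ 0) ∧ x 1 = y (σ 1) ∧ x 2 = y (σ 2) then 1 else 0 := by
  have h : x = y ∘ σ ↔ x 0 = y (σ 0) ∧ x 1 = y (σ 1) ∧ x 2 = y (σ 2) := by
    rw [funext_iff, Fin.forall_fin_succ, Fin.forall_fin_two]
    rfl
  simp only [permOp, Matrix.of_apply, h]

theorem sum_pauli_tensor_three_left :
    ∑ v : BinVec m, tensorProd ![pauliMatrix v, (pauliMatrix v)ᴴ, 1] =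
      (2 : ℂ) ^ m • permOp 3 (Equiv.swap 0 1) := by
  ext x y
  have hσ : (Equiv.swap 0 1 : Equiv.Perm (Fin 3)) 2 = 2 := by decide
  have h : ∀ v : BinVec m, tensorProd ![pauliMatrix v, (pauliMatrix v)ᴴ, 1] x y =
      pauliMatrix v (x 0) (y 0) * star (pauliMatrix v (y 1) (x 1)) *
        (1 : Matrix (Qubits m) (Qubits m) ℂ) (x 2) (y 2) := fun v => by
    simp only [tensorProd, Matrix.of_apply, Fin.prod_univ_three, Matrix.cons_val,
      Matrix.conjTranspose_apply]
  rw [Matrix.sum_apply, Finset.sum_congr rfl fun v _ => h v, ← Finset.sum_mul,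
    sum_pauliMatrix_mul_star, Matrix.smul_apply, permOp_three_apply, Equiv.swap_apply_left,
    Equiv.swap_apply_right, hσ, Matrix.one_apply, smul_eq_mul]
  clear h
  generalize (2 : ℂ) ^ m = N
  grind

theorem sum_pauli_tensor_three_right :
    ∑ v : BinVec m, tensorProd ![1, pauliMatrix v, (pauliMatrix v)ᴴ] =
      (2 : ℂ) ^ m • permOp 3 (Equiv.swap 1 2) := by
  ext x y
  have hσ : (Equiv.swap 1 2 : Equiv.Perm (Fin 3)) 0 = 0 := by decide
  have h : ∀ v : BinVec m, tensorProd ![1, pauliMatrix v, (pauliMatrix v)ᴴ] x y =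
      pauliMatrix v (x 1) (y 1) * star (pauliMatrix v (y 2) (x 2)) *
        (1 : Matrix (Qubits m) (Qubits m) ℂ) (x 0) (y 0) := fun v => by
    simp only [tensorProd, Matrix.of_apply, Fin.prod_univ_three, Matrix.cons_val,
      Matrix.conjTranspose_apply]
    ring
  rw [Matrix.sum_apply, Finset.sum_congr rfl fun v _ => h v, ← Finset.sum_mul,
    sum_pauliMatrix_mul_star, Matrix.smul_apply, permOp_three_apply, Equiv.swap_apply_left,
    Equiv.swap_apply_right, hσ, Matrix.one_apply, smul_eq_mul]
  clear h
  generalize (2 : ℂ) ^ m = N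
  grind

theorem sum_pauli_tensor_three_outer :
    ∑ v : BinVec m, tensorProd ![pauliMatrix v, 1, (pauliMatrix v)ᴴ] =
      (2 : ℂ) ^ m • permOp 3 (Equiv.swap 0 2) := by
  ext x y
  have hσ : (Equiv.swap 0 2 : Equiv.Perm (Fin 3)) 1 = 1 := by decide
  have h : ∀ v : BinVec m, tensorProd ![pauliMatrix v, 1, (pauliMatrix v)ᴴ] x y =
      pauliMatrix v (x 0) (y 0) * star (pauliMatrix v (y 2) (x 2)) *
        (1 : Matrix (Qubits m) (Qubits m) ℂ) (x 1) (y 1) := fun v => by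
    simp only [tensorProd, Matrix.of_apply, Fin.prod_univ_three, Matrix.cons_val,
      Matrix.conjTranspose_apply]
    ring
  rw [Matrix.sum_apply, Finset.sum_congr rfl fun v _ => h v, ← Finset.sum_mul,
    sum_pauliMatrix_mul_star, Matrix.smul_apply, permOp_three_apply, Equiv.swap_apply_left,
    Equiv.swap_apply_right, hσ, Matrix.one_apply, smul_eq_mul]
  clear h
  generalize (2 : ℂ) ^ m = N
  grind

/-- `D(v) ⊗ D(v)† D(w) ⊗ D(w)†`. -/
def pauliTriple (v w : BinVec m) : Matrix (Fin 3 → Qubits m) (Fin 3 → Qubits m) ℂ :=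
  tensorProd ![pauliMatrix v, (pauliMatrix v)ᴴ * pauliMatrix w, (pauliMatrix w)ᴴ]

/-- Once the middle product is opened over an index `z`, the sums over `v` and `w` separate into two
completeness relations, and `z` links them into a 3-cycle. -/
theorem sum_pauliTriple :
    ∑ p : BinVec m × BinVec m, pauliTriple p.1 p.2 =
      ((2 : ℂ) ^ m * 2 ^ m) • permOp 3 (finRotate 3).symm := by
  ext x y
  have h0 : (finRotate 3).symm 0 = 2 := by decide
  have h1 : (finRotate 3).symm 1 = 0 := by decide
  have h2 : (finRotate 3).symm 2 = 1 := by decide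
  have h : ∀ v w : BinVec m, pauliTriple v w x y =
      ∑ z, (pauliMatrix v (x 0) (y 0) * star (pauliMatrix v z (x 1))) *
        (pauliMatrix w z (y 1) * star (pauliMatrix w (y 2) (x 2))) := fun v w => by
    simp only [pauliTriple, tensorProd, Matrix.of_apply, Fin.prod_univ_three, Matrix.cons_val,
      Matrix.mul_apply, Matrix.conjTranspose_apply, Finset.mul_sum, Finset.sum_mul]
    exact Finset.sum_congr rfl fun z _ => by ring
  simp only [Matrix.sum_apply, h]
  rw [Finset.sum_comm]
  simp only [Fintype.sum_prod_type (α₁ := BinVec m), ← Finset.mul_sum, ← Finset.sum_mul,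
    sum_pauliMatrix_mul_star]
  rw [Matrix.smul_apply, permOp_three_apply, h0, h1, h2, smul_eq_mul]
  clear h
  generalize (2 : ℂ) ^ m = N
  simp only [ite_and, mul_ite, mul_zero, ite_mul, zero_mul, Finset.sum_ite_eq',
    Finset.mem_univ, if_true]
  grind

/-- The sign is exactly what turns `D(v)†D(w)` into `D(w)D(v)†`; contracting in this reversed order
yields the inverse 3-cycle. -/
theorem sum_bitSign_smul_pauliTriple :
    ∑ p : BinVec m × BinVec m, bitSign (sympForm p.1 p.2) • pauliTriple p.1 p.2 =
      ((2 : ℂ) ^ m * 2 ^ m) • permOp 3 (finRotate 3) := by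
  ext x y
  have h0 : finRotate 3 0 = 1 := by decide
  have h1 : finRotate 3 1 = 2 := by decide
  have h2 : finRotate 3 2 = 0 := by decide
  have h : ∀ v w : BinVec m, (bitSign (sympForm v w) • pauliTriple v w) x y =
      ∑ z, (pauliMatrix v (x 0) (y 0) * star (pauliMatrix v (y 1) z)) *
        (pauliMatrix w (x 1) z * star (pauliMatrix w (y 2) (x 2))) := fun v w => by
    have hs : bitSign (sympForm v w) * bitSign (sympForm v w) = 1 := by
      rcases bitSign_eq_one_or (sympForm v w) with h | h <;> simp [h]
    simp only [pauliTriple, conjTranspose_pauliMatrix_mul_comm, tensorProd, Matrix.of_apply,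
      Fin.prod_univ_three, Matrix.cons_val, Matrix.smul_apply, smul_eq_mul]
    simp only [Matrix.mul_apply, Matrix.conjTranspose_apply]
    calc _ = bitSign (sympForm v w) * bitSign (sympForm v w) * (pauliMatrix v (x 0) (y 0) *
          (∑ z, pauliMatrix w (x 1) z * star (pauliMatrix v (y 1) z)) *
          star (pauliMatrix w (y 2) (x 2))) := by ring
      _ = _ := by
        rw [hs, one_mul, Finset.mul_sum, Finset.sum_mul]
        exact Finset.sum_congr rfl fun z _ => by ring
  simp only [Matrix.sum_apply, h]
  rw [Finset.sum_comm]
  simp only [Fintype.sum_prod_type (α₁ := BinVec m), ← Finset.mul_sum, ← Finset.sum_mul,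
    sum_pauliMatrix_mul_star]
  rw [Finset.sum_eq_single (y 0) (fun z _ hz => by simp [hz.symm]) (by simp),
    Matrix.smul_apply, permOp_three_apply, h0, h1, h2, smul_eq_mul]
  clear h
  generalize (2 : ℂ) ^ m = N
  grind

end PauliSums

/-! ### Invariant linear maps vanishing on permutation operators are zero. -/

section InvariantFunctionals

variable {m : ℕ} {G : Subgroup (UN m)} {V : Type*} [AddCommGroup V] [Module ℂ V]

theorem eq_zero_of_sum_eq_zero_of_const {α : Type*} {s : Finset α} {f : α → V}
    (hsum : ∑ a ∈ s, f a = 0) (hconst : ∀ a ∈ s, ∀ b ∈ s, f a = f b) {a : α} (ha : a ∈ s) :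
    f a = 0 := by
  rw [Finset.sum_congr rfl fun b hb => hconst b hb a ha, Finset.sum_const,
    ← Nat.cast_smul_eq_nsmul ℂ] at hsum
  exact (smul_eq_zero.1 hsum).resolve_left
    (Nat.cast_ne_zero.2 (Finset.card_ne_zero_of_mem ha))

theorem eq_zero_of_sum_eq_zero_of_const_nonzero {f : BinVec m → V} (hsum : ∑ v, f v = 0)
    (h0 : f 0 = 0) (hconst : ∀ v w : HWVertex m, f v.1 = f w.1) (v : BinVec m) : f v = 0 := by
  by_cases hv : v = 0
  · rw [hv, h0]
  · rw [← Finset.sum_erase _ h0] at hsum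
    exact eq_zero_of_sum_eq_zero_of_const hsum
      (fun a ha b hb => hconst ⟨a, Finset.ne_of_mem_erase ha⟩ ⟨b, Finset.ne_of_mem_erase hb⟩)
      (Finset.mem_erase.2 ⟨hv, Finset.mem_univ _⟩)

/-- Invariance under the Heisenberg-Weyl group kills all Pauli tensors of nonzero total weight. -/
theorem map_pauliTensor_eq_zero_of_sum_ne_zero {k : ℕ} (hPauli : ∀ v : BinVec m, pauliD v ∈ G)
    {F : Matrix (Fin k → Qubits m) (Fin k → Qubits m) ℂ →ₗ[ℂ] V}
    (hF : ∀ g ∈ G, ∀ X, F (tensorConj k g X) = F X) {u : Fin k → BinVec m}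
    (hu : ∑ i, u i ≠ 0) : F (tensorProd fun i => pauliMatrix (u i)) = 0 := by
  obtain ⟨w, hw⟩ := exists_sympForm_eq_one hu
  have h := hF _ (hPauli w) (tensorProd fun i => pauliMatrix (u i))
  rw [tensorConj_tensorProd] at h
  simp only [pauliD, pauliMatrix_conj] at h
  -- By additivity of the form the signs of the factors multiply to the sign of `sympForm w (∑ i, u
  -- i)`, which is `-1`.
  rw [tensorProd_smul (fun i => bitSign (sympForm w (u i))), ← bitSign_sum, ← sympForm_sum_right,
    hw, bitSign_one, map_smul, neg_one_smul] at h
  have h2 := eq_neg_iff_add_eq_zero.1 h.symm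
  rw [← two_smul ℂ] at h2
  exact (smul_eq_zero.1 h2).resolve_left two_ne_zero

theorem linearMap_eq_zero_of_pauliTensor {k : ℕ}
    {F : Matrix (Fin k → Qubits m) (Fin k → Qubits m) ℂ →ₗ[ℂ] V}
    (h : ∀ u : Fin k → BinVec m, F (tensorProd fun i => pauliMatrix (u i)) = 0) : F = 0 :=
  LinearMap.ext_on_range (span_tensorProd_eq_top span_pauliMatrix) h

theorem conj_conjTranspose_of_conj {n : Type*} [Fintype n] {g A B : Matrix n n ℂ} {c : ℂ}
    (h : g * A * gᴴ = c • B) : g * Aᴴ * gᴴ = star c • Bᴴ := by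
  rw [← Matrix.conjTranspose_smul, ← h]
  simp [Matrix.conjTranspose_mul, Matrix.mul_assoc]

theorem conj_mul_conj {n : Type*} [Fintype n] [DecidableEq n] (g : Matrix.unitaryGroup n ℂ)
    (A B : Matrix n n ℂ) : (g : Matrix n n ℂ) * (A * B) * (g : Matrix n n ℂ)ᴴ =
      ((g : Matrix n n ℂ) * A * (g : Matrix n n ℂ)ᴴ) *
        ((g : Matrix n n ℂ) * B * (g : Matrix n n ℂ)ᴴ) := by
  have h : (g : Matrix n n ℂ)ᴴ * (g : Matrix n n ℂ) = 1 := Unitary.star_mul_self_of_mem g.2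
  simp only [Matrix.mul_assoc]
  rw [← Matrix.mul_assoc _ (g : Matrix n n ℂ), h, Matrix.one_mul]

theorem tensorConj_pauliPair {g : UN m} {v w : BinVec m} {c : ℂ} (hc : star c * c = 1)
    (h : (g : Matrix (Qubits m) (Qubits m) ℂ) * pauliMatrix v *
      (g : Matrix (Qubits m) (Qubits m) ℂ)ᴴ = c • pauliMatrix w) :
    tensorConj 2 g (tensorProd ![pauliMatrix v, (pauliMatrix v)ᴴ]) =
      tensorProd ![pauliMatrix w, (pauliMatrix w)ᴴ] := by
  rw [tensorConj_tensorProd]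
  have : (fun i => (g : Matrix (Qubits m) (Qubits m) ℂ) *
      (![pauliMatrix v, (pauliMatrix v)ᴴ] : Fin 2 → _) i *
      (g : Matrix (Qubits m) (Qubits m) ℂ)ᴴ) = fun i =>
      (![c, star c] : Fin 2 → ℂ) i • (![pauliMatrix w, (pauliMatrix w)ᴴ] : Fin 2 → _) i := by
    funext i
    fin_cases i
    · exact h
    · exact conj_conjTranspose_of_conj h
  rw [this, tensorProd_smul]
  simp [mul_comm c, ← starRingEnd_apply] at hc ⊢
  rw [hc, one_smul]

/-- The three factors acquire the phases `c`, `star c * d` and `star d`, whose product is 1. This is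
why the middle factor is written as `D(v)†D(w)`. -/
theorem tensorConj_pauliTriple {g : UN m} {v w v' w' : BinVec m} {c d : ℂ}
    (hc : star c * c = 1) (hd : star d * d = 1)
    (hv : (g : Matrix (Qubits m) (Qubits m) ℂ) * pauliMatrix v *
      (g : Matrix (Qubits m) (Qubits m) ℂ)ᴴ = c • pauliMatrix v')
    (hw : (g : Matrix (Qubits m) (Qubits m) ℂ) * pauliMatrix w *
      (g : Matrix (Qubits m) (Qubits m) ℂ)ᴴ = d • pauliMatrix w') :
    tensorConj 3 g (pauliTriple v w) = pauliTriple v' w' := by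
  rw [pauliTriple, pauliTriple, tensorConj_tensorProd]
  have : (fun i => (g : Matrix (Qubits m) (Qubits m) ℂ) *
      (![pauliMatrix v, (pauliMatrix v)ᴴ * pauliMatrix w, (pauliMatrix w)ᴴ] : Fin 3 → _) i *
      (g : Matrix (Qubits m) (Qubits m) ℂ)ᴴ) = fun i =>
      (![c, star c * d, star d] : Fin 3 → ℂ) i •
      (![pauliMatrix v', (pauliMatrix v')ᴴ * pauliMatrix w', (pauliMatrix w')ᴴ] :
        Fin 3 → _) i := by
    funext i
    fin_cases i
    · exact hv
    · change (g : Matrix (Qubits m) (Qubits m) ℂ) * ((pauliMatrix v)ᴴ * pauliMatrix w) *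
        (g : Matrix (Qubits m) (Qubits m) ℂ)ᴴ =
        (star c * d) • ((pauliMatrix v')ᴴ * pauliMatrix w')
      rw [conj_mul_conj, conj_conjTranspose_of_conj hv, hw, smul_mul_smul_comm]
    · exact conj_conjTranspose_of_conj hw
  have hprod : ∏ i, (![c, star c * d, star d] : Fin 3 → ℂ) i = 1 := by
    rw [Fin.prod_univ_three]
    change c * (star c * d) * star d = 1
    linear_combination (star d * d) * hc + hd
  rw [this, tensorProd_smul, hprod, one_smul]

theorem conj_pauliMatrix_zero (g : UN m) : (g : Matrix (Qubits m) (Qubits m) ℂ) *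
    pauliMatrix (0 : BinVec m) * (g : Matrix (Qubits m) (Qubits m) ℂ)ᴴ =
      (1 : ℂ) • pauliMatrix (0 : BinVec m) := by
  rw [pauliMatrix_zero, Matrix.mul_one, one_smul]
  exact Unitary.mul_star_self_of_mem g.2

theorem permOp_one (k : ℕ) {n : Type*} [Fintype n] [DecidableEq n] :
    permOp k (1 : Equiv.Perm (Fin k)) = (1 : Matrix (Fin k → n) (Fin k → n) ℂ) := by
  ext x y
  simp [permOp, Matrix.one_apply]

theorem map_eq_zero_of_vertexTransitive (hPauli : ∀ v : BinVec m, pauliD v ∈ G)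
    (hV : TransitiveOnVertices G)
    {F : Matrix (Fin 2 → Qubits m) (Fin 2 → Qubits m) ℂ →ₗ[ℂ] V}
    (hF : ∀ g ∈ G, ∀ X, F (tensorConj 2 g X) = F X) (hperm : ∀ σ, F (permOp 2 σ) = 0) :
    F = 0 := by
  have key := eq_zero_of_sum_eq_zero_of_const_nonzero
    (f := fun v : BinVec m => F (tensorProd ![pauliMatrix v, (pauliMatrix v)ᴴ]))
    (by rw [← map_sum, sum_pauli_tensor_two, map_smul, hperm, smul_zero])
    (by
      have : tensorProd ![pauliMatrix (0 : BinVec m), (pauliMatrix (0 : BinVec m))ᴴ] =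
          permOp 2 1 := by
        rw [permOp_one, ← tensorProd_one, pauliMatrix_zero, Matrix.conjTranspose_one]
        congr 1
        funext i
        fin_cases i <;> rfl
      rw [this, hperm])
    (fun v w => by
      obtain ⟨g, hg, h⟩ := hV v w
      obtain ⟨c, hc, h⟩ := h.exists_smul
      rw [← tensorConj_pauliPair hc h, hF g hg])
  refine linearMap_eq_zero_of_pauliTensor fun u => ?_
  by_cases hu : ∑ i, u i = 0
  -- In characteristic 2 a vanishing sum forces equal labels, and `D(v)†` is `D(v)` up to sign, so
  -- the tensor is a nonzero multiple of `D(v) ⊗ D(v)†`.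
  · have h1 : u 1 = u 0 := by
      rw [Fin.sum_univ_two] at hu
      rw [eq_neg_of_add_eq_zero_right hu, ZModModule.neg_eq_self]
    have h2 := key (u 0)
    have h3 : ![pauliMatrix (u 0), (pauliMatrix (u 0))ᴴ] = fun i =>
        (![1, bitSign ((u 0).1 ⬝ᵥ (u 0).2)] : Fin 2 → ℂ) i • pauliMatrix (u i) := by
      funext i
      fin_cases i
      · simp
      · simp [h1, pauliMatrix_conjTranspose]
    rw [h3, tensorProd_smul, map_smul] at h2
    exact (smul_eq_zero.1 h2).resolve_left (by simp [bitSign_ne_zero])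
  · exact map_pauliTensor_eq_zero_of_sum_ne_zero hPauli hF hu

theorem hwGraph_adj_iff (v w : HWVertex m) :
    (hwGraph m).Adj v w ↔ v ≠ w ∧ sympForm v.1 w.1 = 0 :=
  and_congr_right fun _ => commute_pauliE_iff v.1 w.1

/-- Adjacency of distinct vertices is the vanishing of the form, so edges and non-edges are its two
level sets on pairs of distinct vertices. -/
theorem exists_sendsVertex_pair (hE : TransitiveOnEdges G) (hN : TransitiveOnNonEdges G)
    {v v' w w' : HWVertex m} (hv : v ≠ v') (hw : w ≠ w')
    (h : sympForm v.1 v'.1 = sympForm w.1 w'.1) :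
    ∃ g ∈ G, SendsVertex g v w ∧ SendsVertex g v' w' := by
  by_cases h0 : sympForm v.1 v'.1 = 0
  · exact hE v v' w w' ((hwGraph_adj_iff _ _).2 ⟨hv, h0⟩) ((hwGraph_adj_iff _ _).2 ⟨hw, h ▸ h0⟩)
  · exact hN v v' w w' hv (fun ha => h0 ((hwGraph_adj_iff _ _).1 ha).2) hw
      fun ha => h0 (h.trans ((hwGraph_adj_iff _ _).1 ha).2)

/-- The degenerate families go first, each through one transposition. A suitable combination of the
two 3-cycle relations then isolates either edges or non-edges. -/
theorem map_pauliTriple_eq_zero (hV : TransitiveOnVertices G)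
    (hE : TransitiveOnEdges G) (hN : TransitiveOnNonEdges G)
    {F : Matrix (Fin 3 → Qubits m) (Fin 3 → Qubits m) ℂ →ₗ[ℂ] V}
    (hF : ∀ g ∈ G, ∀ X, F (tensorConj 3 g X) = F X) (hperm : ∀ σ, F (permOp 3 σ) = 0)
    (v w : BinVec m) : F (pauliTriple v w) = 0 := by
  have h00 : F (pauliTriple (0 : BinVec m) 0) = 0 := by
    have : pauliTriple (0 : BinVec m) 0 = permOp 3 1 := by
      rw [permOp_one, ← tensorProd_one, pauliTriple, pauliMatrix_zero, Matrix.conjTranspose_one,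
        Matrix.one_mul]
      congr 1
      funext i
      fin_cases i <;> rfl
    rw [this, hperm]
  have hone : star (1 : ℂ) * 1 = 1 := by simp
  have hleft : ∀ v : BinVec m, F (pauliTriple v 0) = 0 :=
    eq_zero_of_sum_eq_zero_of_const_nonzero
      (by
        simp only [pauliTriple, pauliMatrix_zero, Matrix.conjTranspose_one, Matrix.mul_one]
        rw [← map_sum, sum_pauli_tensor_three_left, map_smul, hperm, smul_zero])
      h00
      fun v w => by
        obtain ⟨g, hg, h⟩ := hV v w
        obtain ⟨c, hc, h⟩ := h.exists_smul
        rw [← tensorConj_pauliTriple hc hone h (conj_pauliMatrix_zero g), hF g hg]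
  have hright : ∀ v : BinVec m, F (pauliTriple 0 v) = 0 :=
    eq_zero_of_sum_eq_zero_of_const_nonzero
      (by
        simp only [pauliTriple, pauliMatrix_zero, Matrix.conjTranspose_one, Matrix.one_mul]
        rw [← map_sum, sum_pauli_tensor_three_right, map_smul, hperm, smul_zero])
      h00
      fun v w => by
        obtain ⟨g, hg, h⟩ := hV v w
        obtain ⟨c, hc, h⟩ := h.exists_smul
        rw [← tensorConj_pauliTriple hone hc (conj_pauliMatrix_zero g) h, hF g hg]
  have hdiag : ∀ v : BinVec m, F (pauliTriple v v) = 0 :=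
    eq_zero_of_sum_eq_zero_of_const_nonzero
      (by
        simp only [pauliTriple, pauliMatrix_conjTranspose_mul]
        rw [← map_sum, sum_pauli_tensor_three_outer, map_smul, hperm, smul_zero])
      h00
      fun v w => by
        obtain ⟨g, hg, h⟩ := hV v w
        obtain ⟨c, hc, h⟩ := h.exists_smul
        rw [← tensorConj_pauliTriple hc hc h h, hF g hg]
  by_cases hv : v = 0
  · rw [hv, hright]
  by_cases hw : w = 0
  · rw [hw, hleft]
  by_cases hvw : v = w
  · rw [hvw, hdiag]
  -- Weight the pairs so that only those with the same commutation relation as `(v, w)` survive.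
  set ε := bitSign (sympForm v w) with hε
  let f : BinVec m × BinVec m → V := fun p =>
    (1 + ε * bitSign (sympForm p.1 p.2)) • F (pauliTriple p.1 p.2)
  let s : Finset (BinVec m × BinVec m) := Finset.univ.filter fun p =>
    p.1 ≠ 0 ∧ p.2 ≠ 0 ∧ p.1 ≠ p.2 ∧ sympForm p.1 p.2 = sympForm v w
  -- The weight splits the sum into the plain and the signed one, both multiples of 3-cycles.
  have hsum : ∑ p, f p = 0 := by
    simp only [f, add_smul, one_smul, mul_smul, Finset.sum_add_distrib, ← Finset.smul_sum]
    simp only [← map_smul F (bitSign _), ← map_sum, sum_pauliTriple, sum_bitSign_smul_pauliTriple]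
    simp [hperm]
  have hs : ∑ p ∈ s, f p = 0 := by
    rw [← hsum]
    refine Finset.sum_subset (Finset.subset_univ _) fun p _ hp => ?_
    by_contra hne
    refine hp (Finset.mem_filter.2 ⟨Finset.mem_univ _, ?_, ?_, ?_, ?_⟩)
    · exact fun h => hne (by simp only [f, h, hright, smul_zero])
    · exact fun h => hne (by simp only [f, h, hleft, smul_zero])
    · exact fun h => hne (by simp only [f, h, hdiag, smul_zero])
    · by_contra h
      refine hne ?_
      -- A pair with the other commutation relation has the opposite sign, so its weight is zero.
      have h' : ε * bitSign (sympForm p.1 p.2) = -1 := by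
        rcases zmodTwo_eq_zero_or_one (sympForm v w) with h1 | h1 <;>
          rcases zmodTwo_eq_zero_or_one (sympForm p.1 p.2) with h2 | h2 <;>
          simp_all [bitSign_zero, bitSign_one]
      simp only [f, h', add_neg_cancel, zero_smul]
  have hconst : ∀ p ∈ s, ∀ q ∈ s, f p = f q := by
    intro p hp q hq
    obtain ⟨-, hp1, hp2, hp3, hp⟩ := Finset.mem_filter.1 hp
    obtain ⟨-, hq1, hq2, hq3, hq⟩ := Finset.mem_filter.1 hq
    obtain ⟨g, hg, h1, h2⟩ := exists_sendsVertex_pair hE hN (v := ⟨p.1, hp1⟩) (v' := ⟨p.2, hp2⟩)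
      (w := ⟨q.1, hq1⟩) (w' := ⟨q.2, hq2⟩) (fun h => hp3 (congrArg Subtype.val h))
      (fun h => hq3 (congrArg Subtype.val h)) (hp.trans hq.symm)
    obtain ⟨c, hc, h1⟩ := h1.exists_smul
    obtain ⟨d, hd, h2⟩ := h2.exists_smul
    simp only [f, hp, hq]
    rw [← tensorConj_pauliTriple hc hd h1 h2, hF g hg]
  have h0 : f (v, w) = 0 := eq_zero_of_sum_eq_zero_of_const hs hconst
    (Finset.mem_filter.2 ⟨Finset.mem_univ _, hv, hw, hvw, rfl⟩)
  refine (smul_eq_zero.1 h0).resolve_left ?_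
  -- The weight at `(v, w)` itself is 2, so it can be divided out.
  have : ε * ε = 1 := by rcases bitSign_eq_one_or (sympForm v w) with h | h <;> simp [hε, h]
  change 1 + ε * ε ≠ 0
  rw [this]
  norm_num

theorem map_eq_zero_of_edgeTransitive (hPauli : ∀ v : BinVec m, pauliD v ∈ G)
    (hV : TransitiveOnVertices G) (hE : TransitiveOnEdges G) (hN : TransitiveOnNonEdges G)
    {F : Matrix (Fin 3 → Qubits m) (Fin 3 → Qubits m) ℂ →ₗ[ℂ] V}
    (hF : ∀ g ∈ G, ∀ X, F (tensorConj 3 g X) = F X) (hperm : ∀ σ, F (permOp 3 σ) = 0) :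
    F = 0 := by
  refine linearMap_eq_zero_of_pauliTensor fun u => ?_
  by_cases hu : ∑ i, u i = 0
  -- The middle label is the sum of the outer two, so `D(u 1)` agrees up to sign with `D(u 0)†D(u
  -- 2)`.
  · have h1 : u 1 = u 0 + u 2 := by
      rw [Fin.sum_univ_three, add_right_comm] at hu
      rw [eq_neg_of_add_eq_zero_right hu, ZModModule.neg_eq_self]
    have h2 := map_pauliTriple_eq_zero hV hE hN hF hperm (u 0) (u 2)
    have h3 : ![pauliMatrix (u 0), (pauliMatrix (u 0))ᴴ * pauliMatrix (u 2),
        (pauliMatrix (u 2))ᴴ] = fun i =>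
        (![1, bitSign ((u 0).1 ⬝ᵥ (u 0).2) * bitSign ((u 0).2 ⬝ᵥ (u 2).1),
          bitSign ((u 2).1 ⬝ᵥ (u 2).2)] : Fin 3 → ℂ) i • pauliMatrix (u i) := by
      funext i
      fin_cases i
      · simp
      · simp [h1, pauliMatrix_conjTranspose, pauliMatrix_mul, smul_smul]
      · simp [pauliMatrix_conjTranspose]
    rw [pauliTriple, h3, tensorProd_smul, map_smul] at h2
    exact (smul_eq_zero.1 h2).resolve_left (by simp [Fin.prod_univ_three, bitSign_ne_zero])
  · exact map_pauliTensor_eq_zero_of_sum_ne_zero hPauli hF hu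

end InvariantFunctionals
end

theorem mainTheorem3 (m : ℕ) (G : Subgroup (UN m))
    (hCliff : (G : Set (UN m)) ⊆ cliffordGroup m)
    (hPauli : ∀ v : BinVec m, pauliD v ∈ G)
    (S : Finset (UN m)) (hne : S.Nonempty)
    (hS : (S : Set (UN m)) = G ∨ IsPhaseTransversal G S) :
    (TransitiveOnVertices G → (uniformEnsemble S hne).IsDesign 2) ∧
    (TransitiveOnVertices G → TransitiveOnEdges G → TransitiveOnNonEdges G →
      (uniformEnsemble S hne).IsDesign 3) := by
  refine ⟨fun hV => UnitaryEnsemble.isDesign_of_twirlDefect_eq_zero ?_,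
    fun hV hE hN => UnitaryEnsemble.isDesign_of_twirlDefect_eq_zero ?_⟩
  · exact map_eq_zero_of_vertexTransitive hPauli hV
      (fun g hg => twirlDefect_uniformEnsemble_tensorConj hne hS hg 2)
      (UnitaryEnsemble.twirlDefect_permOp _ 2)
  · exact map_eq_zero_of_edgeTransitive hPauli hV hE hN
      (fun g hg => twirlDefect_uniformEnsemble_tensorConj hne hS hg 3)
      (UnitaryEnsemble.twirlDefect_permOp _ 3)
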